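/- Let $(p_n)_{n\ge 1}$ be any sequence in $[0,1]$. For each $n$, choose $n$ points independently and uniformly at random from the unit square $[0,1]^2$, and form a random graph $G$ on these points by joining each pair independently with probability $p=p_n$ (independently of the positions). Give every edge weight equal to the Euclidean distance $d$ of its ends, and let $d_G(u,v)$ be the shortest-path distance in the weighted graph ($d_G(u,v)=\infty$ if there is no path from $u$ to $v$). Let $$\mathcal F(n,p)=\max_{u\ne v}\frac{d_G(u,v)}{d(u,v)}$$ be the stretch factor of $G$, so that $\mathcal F(n,p)=\infty$ if $G$ is disconnected. Then for every function $w:\mathbb N\to\mathbb R$ with $w(n)\to\infty$, $$\mathbf{Pr}\left[\mathcal F(n,p)>\frac{\sqrt{n(1-p)}}{w(n)}\right]\longrightarrow 1\qquad(n\to\infty).$$ Consequently, if $n(1-p)\to\infty$, then for every fixed constant $\lambda$ we have $\mathbf{Pr}[\mathcal F(n,p)>\lambda]\to 1$ as $n\to\infty$. -/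

import Mathlib

open MeasureTheory ProbabilityTheory Filter Topology
open scoped ENNReal

noncomputable section

namespace StretchFactor

/-- The Euclidean plane. -/
abbrev Plane : Type := EuclideanSpace ℝ (Fin 2)

/-- The unit square `[0,1] × [0,1]`. -/
def unitSquare : Set Plane := {a | ∀ i, a i ∈ Set.Icc (0 : ℝ) 1}

/-- The length of a walk in a graph whose vertices are embedded in the plane by `x`: every edge
has weight equal to the Euclidean distance between its ends. -/
def walkLength {V : Type*} (x : V → Plane) {G : SimpleGraph V} {u v : V} (q : G.Walk u v) : ℝ≥0∞ :=
  (q.darts.map fun e => edist (x e.fst) (x e.snd)).sum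

/-- The shortest-path distance `d_G(u, v)` in the weighted graph; it is `⊤` when `u` and `v` are in
different components. -/
def graphDist {V : Type*} (x : V → Plane) (G : SimpleGraph V) (u v : V) : ℝ≥0∞ :=
  ⨅ q : G.Walk u v, walkLength x q

/-- The stretch factor of the embedded graph: the largest ratio `d_G(u, v) / d(u, v)` over all pairs
of distinct vertices. A disconnected graph has stretch factor `⊤`. -/
def stretchFactor {V : Type*} (x : V → Plane) (G : SimpleGraph V) : ℝ≥0∞ :=
  ⨆ (u : V) (v : V) (_ : u ≠ v), graphDist x G u v / edist (x u) (x v)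

/-- The law of the randomly embedded random graph: `n` independent uniform points of the unit
square and, independently of them, a binomial random graph, in which every pair of the `n` vertices
is joined independently with probability `p`. -/
def randomEmbeddedGraph (n : ℕ) (p : unitInterval) :
    Measure ((Fin n → Plane) × SimpleGraph (Fin n)) :=
  (Measure.pi fun _ : Fin n => ProbabilityTheory.cond (volume : Measure Plane) unitSquare).prod
    (SimpleGraph.binomialRandom (Fin n) p)

end StretchFactor

end

/-! Write q = 1 - p. If u and v are non-adjacent, at distance at most r, and no other point lies
within R of u, then every walk from u to v starts with an edge of length at least R, so the stretch
factor is at least R/r (`ofReal_div_le_stretchFactor`). It remains to find such a pair with high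
probability.

The number of close non-adjacent pairs has mean of order n²r²q. Disjoint pairs are independent, and
pairs sharing one vertex still have joint probability O((r²q)²), so Chebyshev gives concentration
with error O(1/(n²r²q) + 1/n). A third point near u costs a further factor O(nR²) in expectation,
and Markov handles these crowded pairs (`measureReal_compl_iUnion_diff_le`,
`real_compl_iUnion_closeNonadj_diff_crowded_le`).

Taking r² = w/(4n²q) and R² = 1/(nw) makes every error O(1/w + 1/n), while R/r = 2√(nq)/w. This
needs √(nq) ≥ w; otherwise the threshold is below 1, and the stretch factor is almost surely at
least 1. -/

namespace StretchFactor

/-! ### The uniform measure on the unit square -/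

/-- The uniform probability measure on the unit square. -/
noncomputable abbrev squareMeasure : Measure Plane :=
  ProbabilityTheory.cond (volume : Measure Plane) unitSquare

lemma unitSquare_eq_preimage :
    unitSquare = (MeasurableEquiv.toLp 2 (Fin 2 → ℝ)).symm ⁻¹'
      (Set.Icc (fun _ => (0 : ℝ)) (fun _ => 1)) := by
  ext a
  simp only [unitSquare, Set.mem_ofPred_eq, Set.mem_preimage, Set.mem_Icc, Pi.le_def]
  exact forall_and

lemma measurableSet_unitSquare : MeasurableSet unitSquare := by
  rw [unitSquare_eq_preimage]
  exact (MeasurableEquiv.toLp 2 (Fin 2 → ℝ)).symm.measurable measurableSet_Icc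

lemma volume_unitSquare : (volume : Measure Plane) unitSquare = 1 := by
  rw [unitSquare_eq_preimage,
    (EuclideanSpace.volume_preserving_symm_measurableEquiv_toLp (Fin 2)).measure_preimage_equiv,
    Real.volume_Icc_pi]
  simp

instance : IsProbabilityMeasure squareMeasure :=
  cond_isProbabilityMeasure_of_finite (by simp [volume_unitSquare]) (by simp [volume_unitSquare])

lemma squareMeasure_apply (s : Set Plane) :
    squareMeasure s = (volume : Measure Plane) (unitSquare ∩ s) := by
  rw [squareMeasure, cond_apply measurableSet_unitSquare, volume_unitSquare]
  simp

lemma squareMeasure_closedBall_le (a : Plane) {r : ℝ} (hr : 0 ≤ r) :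
    squareMeasure (Metric.closedBall a r) ≤ ENNReal.ofReal (Real.pi * r ^ 2) := by
  rw [squareMeasure_apply]
  refine (measure_mono Set.inter_subset_right).trans ?_
  rw [EuclideanSpace.volume_closedBall_fin_two, mul_comm Real.pi,
    ENNReal.ofReal_mul (by positivity), ENNReal.ofReal_pow hr]

/-- Moving `a` a little towards the centre of the square makes room for a ball inside the square. -/
lemma exists_closedBall_subset_unitSquare {a : Plane} (ha : a ∈ unitSquare) {r : ℝ} (hr : 0 ≤ r)
    (hr1 : r ≤ 1) :
    ∃ b : Plane, Metric.closedBall b (r / 4) ⊆ unitSquare ∩ Metric.closedBall a r := by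
  -- Each coordinate is (1 - r/2) a i + r/4, which lies in [r/4, 1 - r/4] and within r/4 of a i.
  -- Hence the new centre is within r/2 of `a`, and r/2 + r/4 ≤ r.
  refine ⟨WithLp.toLp 2 fun i => a i + r / 2 * (1 / 2 - a i), fun x hx => ?_⟩
  set b : Plane := WithLp.toLp 2 fun i => a i + r / 2 * (1 / 2 - a i) with hb
  have hbi (i : Fin 2) : b i = a i + r / 2 * (1 / 2 - a i) := rfl
  have hx' : ‖x - b‖ ≤ r / 4 := by simpa [dist_eq_norm] using hx
  refine ⟨fun i => ?_, ?_⟩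
  · have h1 : ‖(x - b) i‖ ≤ r / 4 := (PiLp.norm_apply_le (x - b) i).trans hx'
    rw [PiLp.sub_apply, Real.norm_eq_abs, abs_le, hbi] at h1
    obtain ⟨h0, h2⟩ := ha i
    constructor <;> nlinarith
  · have h2 : dist b a ≤ r / 2 := by
      rw [EuclideanSpace.dist_eq, Real.sqrt_le_left (by positivity)]
      have h (i : Fin 2) : dist (b i) (a i) ^ 2 ≤ r ^ 2 / 16 := by
        rw [hbi, Real.dist_eq, sq_abs]
        obtain ⟨h0, h2⟩ := ha i
        have : (1 / 2 - a i) ^ 2 ≤ 1 / 4 := by nlinarith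
        nlinarith [sq_nonneg r]
      rw [Fin.sum_univ_two]
      nlinarith [h 0, h 1, sq_nonneg r]
    have h3 := dist_triangle x b a
    have : dist x b ≤ r / 4 := hx
    simp only [Metric.mem_closedBall]
    linarith

lemma le_squareMeasure_closedBall {a : Plane} (ha : a ∈ unitSquare) {r : ℝ} (hr : 0 ≤ r)
    (hr1 : r ≤ 1) :
    ENNReal.ofReal (Real.pi / 16 * r ^ 2) ≤ squareMeasure (Metric.closedBall a r) := by
  obtain ⟨b, hb⟩ := exists_closedBall_subset_unitSquare ha hr hr1
  rw [squareMeasure_apply]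
  refine le_trans (le_of_eq ?_) (measure_mono hb)
  rw [EuclideanSpace.volume_closedBall_fin_two,
    show Real.pi / 16 * r ^ 2 = (r / 4) ^ 2 * Real.pi by ring,
    ENNReal.ofReal_mul (by positivity), ENNReal.ofReal_pow (by positivity)]

/-! ### Independent uniform points -/

lemma measurableSet_dist_le {ι : Type*} (a b : ι) (r : ℝ) :
    MeasurableSet {x : ι → Plane | dist (x a) (x b) ≤ r} :=
  measurableSet_le (by fun_prop) measurable_const

section Points

variable {ι : Type*} [Fintype ι]

/-- The law of a family of independent uniform points of the unit square. -/
noncomputable abbrev pointsMeasure (ι : Type*) [Fintype ι] : Measure (ι → Plane) :=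
  Measure.pi fun _ : ι => squareMeasure

lemma iIndepFun_points : iIndepFun (fun (i : ι) (x : ι → Plane) => x i) (pointsMeasure ι) :=
  iIndepFun_pi (X := fun _ => id) fun _ => aemeasurable_id

lemma map_eval_pointsMeasure (a : ι) :
    (pointsMeasure ι).map (fun x => x a) = squareMeasure :=
  (measurePreserving_eval (fun _ : ι => squareMeasure) a).map_eq

lemma map_pair_pointsMeasure {a b : ι} (hab : a ≠ b) :
    (pointsMeasure ι).map (fun x => (x a, x b)) = squareMeasure.prod squareMeasure := by
  rw [(indepFun_iff_map_prod_eq_prod_map_map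
      (measurable_pi_apply _).aemeasurable
      (measurable_pi_apply _).aemeasurable).1
    (iIndepFun_points.indepFun hab), map_eval_pointsMeasure, map_eval_pointsMeasure]

lemma map_triple_pointsMeasure {a b c : ι} (hab : a ≠ b) (hac : a ≠ c) (hbc : b ≠ c) :
    (pointsMeasure ι).map (fun x => ((x b, x c), x a)) =
      (squareMeasure.prod squareMeasure).prod squareMeasure := by
  rw [(indepFun_iff_map_prod_eq_prod_map_map
      (by fun_prop)
      (measurable_pi_apply _).aemeasurable).1
    (iIndepFun_points.indepFun_prodMk (fun _ => by fun_prop) b c a hab.symm hac.symm),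
    map_eval_pointsMeasure, map_pair_pointsMeasure hbc]

lemma pointsMeasure_dist_le_eq {a b : ι} (hab : a ≠ b) (r : ℝ) :
    pointsMeasure ι {x | dist (x a) (x b) ≤ r} =
      ∫⁻ y, squareMeasure (Metric.closedBall y r) ∂squareMeasure := by
  have hm : MeasurableSet {y : Plane × Plane | dist y.1 y.2 ≤ r} :=
    measurableSet_le (by fun_prop) measurable_const
  have h := Measure.map_apply (μ := pointsMeasure ι) (f := fun x => (x a, x b)) (by fun_prop) hm
  rw [map_pair_pointsMeasure hab, Measure.prod_apply hm] at h
  refine h.symm.trans (lintegral_congr fun y => ?_)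
  congr 1
  ext z
  simp [dist_comm]

lemma pointsMeasure_dist_le_le {a b : ι} (hab : a ≠ b) {r : ℝ} (hr : 0 ≤ r) :
    pointsMeasure ι {x | dist (x a) (x b) ≤ r} ≤ ENNReal.ofReal (Real.pi * r ^ 2) := by
  rw [pointsMeasure_dist_le_eq hab]
  refine (lintegral_mono fun y => squareMeasure_closedBall_le y hr).trans ?_
  simp

lemma le_pointsMeasure_dist_le {a b : ι} (hab : a ≠ b) {r : ℝ} (hr : 0 ≤ r) (hr1 : r ≤ 1) :
    ENNReal.ofReal (Real.pi / 16 * r ^ 2) ≤ pointsMeasure ι {x | dist (x a) (x b) ≤ r} := by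
  rw [pointsMeasure_dist_le_eq hab]
  calc ENNReal.ofReal (Real.pi / 16 * r ^ 2)
      = ∫⁻ _, ENNReal.ofReal (Real.pi / 16 * r ^ 2) ∂squareMeasure := by simp
    _ ≤ _ := lintegral_mono_ae <| by
        filter_upwards [ae_cond_mem measurableSet_unitSquare] with y hy
        exact le_squareMeasure_closedBall hy hr hr1

/-- Once the shared point is fixed, the other two fall independently into discs around it, so the
bound is a product despite the shared vertex. -/
lemma pointsMeasure_dist_le_dist_le_le {a b c : ι} (hab : a ≠ b) (hac : a ≠ c) (hbc : b ≠ c)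
    {r R : ℝ} (hr : 0 ≤ r) (hR : 0 ≤ R) :
    pointsMeasure ι ({x | dist (x a) (x b) ≤ r} ∩ {x | dist (x a) (x c) ≤ R}) ≤
      ENNReal.ofReal (Real.pi * r ^ 2) * ENNReal.ofReal (Real.pi * R ^ 2) := by
  have hm : MeasurableSet {y : (Plane × Plane) × Plane | dist y.2 y.1.1 ≤ r ∧ dist y.2 y.1.2 ≤ R} :=
    .inter (measurableSet_le (f := fun y : (Plane × Plane) × Plane => dist y.2 y.1.1) (by fun_prop)
      measurable_const) (measurableSet_le (f := fun y : (Plane × Plane) × Plane => dist y.2 y.1.2)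
      (by fun_prop) measurable_const)
  have h := Measure.map_apply (μ := pointsMeasure ι) (f := fun x => ((x b, x c), x a))
    (by fun_prop) hm
  rw [map_triple_pointsMeasure hab hac hbc, Measure.prod_apply_symm hm] at h
  refine (h.symm.trans_le (lintegral_mono fun y => ?_)).trans
    (?_ : ∫⁻ _, ENNReal.ofReal (Real.pi * r ^ 2) * ENNReal.ofReal (Real.pi * R ^ 2)
      ∂squareMeasure ≤ _)
  · have hs : (fun x : Plane × Plane => (x, y)) ⁻¹'
        {y : (Plane × Plane) × Plane | dist y.2 y.1.1 ≤ r ∧ dist y.2 y.1.2 ≤ R} =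
        Metric.closedBall y r ×ˢ Metric.closedBall y R := by
      ext z
      simp [dist_comm]
    simp only [hs, Measure.prod_prod]
    exact mul_le_mul' (squareMeasure_closedBall_le y hr) (squareMeasure_closedBall_le y hR)
  · simp

lemma pointsMeasure_inter_of_disjoint {a b c d : ι} (hac : a ≠ c) (had : a ≠ d) (hbc : b ≠ c)
    (hbd : b ≠ d) (r : ℝ) :
    pointsMeasure ι ({x | dist (x a) (x b) ≤ r} ∩ {x | dist (x c) (x d) ≤ r}) =
      pointsMeasure ι {x | dist (x a) (x b) ≤ r} * pointsMeasure ι {x | dist (x c) (x d) ≤ r} := by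
  have hm : MeasurableSet {y : Plane × Plane | dist y.1 y.2 ≤ r} :=
    measurableSet_le (by fun_prop) measurable_const
  exact (iIndepFun_points.indepFun_prodMk_prodMk (fun _ => by fun_prop) a b c d hac had hbc
    hbd).measure_inter_preimage_eq_mul _ _ hm hm

end Points

/-! ### Missing edges of a binomial random graph -/

lemma binomialRandom_forall_notMem_edgeSet {V : Type*} [Countable V] (p : unitInterval)
    (t : Finset (Sym2 V)) (ht : ∀ e ∈ t, ¬ e.IsDiag) :
    SimpleGraph.binomialRandom V p {G | ∀ e ∈ t, e ∉ G.edgeSet} =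
      ENNReal.ofReal (1 - p) ^ t.card := by
  have hm : MeasurableSet {s : Set (Sym2 V) | ∀ e ∈ t, e ∉ s} := by
    have : {s : Set (Sym2 V) | ∀ e ∈ t, e ∉ s} = ⋂ e ∈ t, {s | e ∈ s}ᶜ := by ext; simp
    rw [this]
    exact Finset.measurableSet_biInter _ fun e _ => (measurableSet_mem e).compl
  have hpre : {G : SimpleGraph V | ∀ e ∈ t, e ∉ G.edgeSet} =
      SimpleGraph.edgeSet ⁻¹' {s : Set (Sym2 V) | ∀ e ∈ t, e ∉ s} := rfl
  have hm' : MeasurableSet {G : SimpleGraph V | ∀ e ∈ t, e ∉ G.edgeSet} := by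
    rw [hpre]
    exact SimpleGraph.measurable_edgeSet hm
  rw [SimpleGraph.binomialRandom_eq_map, Measure.map_apply SimpleGraph.measurable_fromEdgeSet hm',
    setBernoulli_apply']
  -- For a non-loop, being absent from the graph is the same as being absent from the random set, so
  -- the event is a cylinder. Loops are dropped by `fromEdgeSet` and would impose no condition.
  have hS : (fun p : Sym2 V → Prop => {i | p i}) ⁻¹' (SimpleGraph.fromEdgeSet ⁻¹'
      {G : SimpleGraph V | ∀ e ∈ t, e ∉ G.edgeSet}) = Set.pi t fun _ => {False} := by
    ext f
    simp only [Set.mem_preimage, Set.mem_ofPred_eq, SimpleGraph.edgeSet_fromEdgeSet, Set.mem_pi,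
      Set.mem_singleton_iff, eq_iff_iff, iff_false]
    refine forall₂_congr fun e he => ?_
    simp [ht e he]
  rw [hS, Measure.infinitePi_pi _ (fun _ _ => .of_discrete)]
  rw [Finset.prod_congr rfl (g := fun _ => ENNReal.ofReal (1 - p)), Finset.prod_const]
  intro e he
  have := ht e he
  have hq : unitInterval.toNNReal (unitInterval.symm p) = (1 - (p : ℝ)).toNNReal :=
    NNReal.eq (by simp [p.2.2])
  simp [this, hq, ENNReal.ofReal]

lemma binomialRandom_not_adj {V : Type*} [Countable V] (p : unitInterval) {a b : V} (hab : a ≠ b) :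
    SimpleGraph.binomialRandom V p {G | ¬ G.Adj a b} = ENNReal.ofReal (1 - p) := by
  have h := binomialRandom_forall_notMem_edgeSet p {s(a, b)} (by simpa)
  simpa using h

lemma binomialRandom_not_adj_inter {V : Type*} [Countable V] (p : unitInterval) {a b c d : V}
    (hab : a ≠ b) (hcd : c ≠ d) (h : s(a, b) ≠ s(c, d)) :
    SimpleGraph.binomialRandom V p ({G | ¬ G.Adj a b} ∩ {G | ¬ G.Adj c d}) =
      ENNReal.ofReal (1 - p) * ENNReal.ofReal (1 - p) := by
  classical
  have h := binomialRandom_forall_notMem_edgeSet p {s(a, b), s(c, d)} (by simp [hab, hcd])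
  rw [Finset.card_pair ‹_›, sq] at h
  rw [← h]
  congr 1
  ext G
  simp

lemma measurableSet_not_adj {V : Type*} (a b : V) :
    MeasurableSet {G : SimpleGraph V | ¬ G.Adj a b} :=
  (SimpleGraph.measurable_edgeSet (measurableSet_mem s(a, b))).compl

/-! ### A second moment bound -/

section SecondMoment

variable {Ω ι : Type*} [MeasurableSpace Ω] {P : Measure Ω} [IsProbabilityMeasure P]

lemma memLp_indicator_one {E : Set Ω} (hE : MeasurableSet E) :
    MemLp (E.indicator fun _ => (1 : ℝ)) 2 P :=
  memLp_indicator_const 2 hE 1 (Or.inr (measure_ne_top P E))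

lemma covariance_indicator_one {E F : Set Ω} (hE : MeasurableSet E) (hF : MeasurableSet F) :
    cov[E.indicator fun _ => (1 : ℝ), F.indicator fun _ => (1 : ℝ); P] =
      P.real (E ∩ F) - P.real E * P.real F := by
  rw [covariance_eq_sub (memLp_indicator_one hE) (memLp_indicator_one hF),
    integral_indicator_const _ hE, integral_indicator_const _ hF]
  have : (E.indicator fun _ => (1 : ℝ)) * (F.indicator fun _ => (1 : ℝ)) =
      (E ∩ F).indicator fun _ => (1 : ℝ) := by
    ext ω
    by_cases h1 : ω ∈ E <;> by_cases h2 : ω ∈ F <;> simp [h1, h2]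
  rw [this, integral_indicator_const _ (hE.inter hF)]
  simp

lemma integral_sum_indicator_one (s : Finset ι) {E : ι → Set Ω}
    (hE : ∀ i, MeasurableSet (E i)) :
    P[fun ω => ∑ i ∈ s, (E i).indicator (fun _ => (1 : ℝ)) ω] = ∑ i ∈ s, P.real (E i) := by
  rw [integral_finsetSum _ fun i _ => (memLp_indicator_one (hE i)).integrable (by simp)]
  exact Finset.sum_congr rfl fun i _ => by rw [integral_indicator_const _ (hE i)]; simp

/-- The variance of a sum of indicators with sparse dependence. -/
lemma variance_sum_indicator_le (s : Finset ι) {E : ι → Set Ω}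
    (hE : ∀ i, MeasurableSet (E i)) (N : ι → ι → Prop) [DecidableRel N] {K d : ℝ} (hK : 0 ≤ K)
    (hindep : ∀ i ∈ s, ∀ j ∈ s, ¬ N i j → P.real (E i ∩ E j) ≤ P.real (E i) * P.real (E j))
    (hdep : ∀ i ∈ s, ∀ j ∈ s, i ≠ j → N i j → P.real (E i ∩ E j) ≤ K)
    (hd : ∀ i ∈ s, ((s.filter (N i)).card : ℝ) ≤ d) :
    Var[fun ω => ∑ i ∈ s, (E i).indicator (fun _ => (1 : ℝ)) ω; P] ≤
      ∑ i ∈ s, P.real (E i) + s.card * (d * K) := by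
  classical
  rw [variance_fun_sum' fun i _ => memLp_indicator_one (hE i)]
  have hrow (i : ι) (hi : i ∈ s) :
      ∑ j ∈ s, cov[(E i).indicator fun _ => (1 : ℝ), (E j).indicator fun _ => (1 : ℝ); P] ≤
        P.real (E i) + d * K := by
    -- Covariances are at most P(E i) on the diagonal, at most K for dependent pairs, and at most 0
    -- otherwise.
    calc _ ≤ ∑ j ∈ s, ((if i = j then P.real (E i) else 0) + if N i j then K else 0) := by
          refine Finset.sum_le_sum fun j hj => ?_
          rw [covariance_indicator_one (hE i) (hE j)]
          have hpos : 0 ≤ P.real (E i) * P.real (E j) := by positivity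
          have h0 : 0 ≤ P.real (E i) := by positivity
          have hN : 0 ≤ if N i j then K else 0 := by split_ifs <;> simp [hK]
          by_cases hij : i = j
          · subst hij
            simp only [Set.inter_self, if_true]
            linarith
          · by_cases hNij : N i j
            · have := hdep i hi j hj hij hNij
              simp only [hij, hNij, if_true, if_false]
              linarith
            · have := hindep i hi j hj hNij
              simp only [hij, hNij, if_false]
              linarith
      _ = P.real (E i) + (s.filter (N i)).card * K := by
          rw [Finset.sum_add_distrib, Finset.sum_ite_eq, if_pos hi, ← Finset.sum_filter,
            Finset.sum_const, nsmul_eq_mul]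
      _ ≤ P.real (E i) + d * K := by
          gcongr
          exact hd i hi
  calc _ ≤ ∑ i ∈ s, (P.real (E i) + d * K) := Finset.sum_le_sum hrow
    _ = _ := by rw [Finset.sum_add_distrib, Finset.sum_const, nsmul_eq_mul]

/-- If the events `E i` are sparsely dependent and `B i` are rare, some `E i` occurs without `B i`,
except with a small probability. -/
lemma measureReal_compl_iUnion_diff_le (s : Finset ι) {E B : ι → Set Ω}
    (hE : ∀ i, MeasurableSet (E i)) (hB : ∀ i, MeasurableSet (B i))
    (N : ι → ι → Prop) [DecidableRel N] {K d β : ℝ} (hK : 0 ≤ K)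
    (hindep : ∀ i ∈ s, ∀ j ∈ s, ¬ N i j → P.real (E i ∩ E j) ≤ P.real (E i) * P.real (E j))
    (hdep : ∀ i ∈ s, ∀ j ∈ s, i ≠ j → N i j → P.real (E i ∩ E j) ≤ K)
    (hd : ∀ i ∈ s, ((s.filter (N i)).card : ℝ) ≤ d)
    (hβ : ∀ i ∈ s, P.real (B i) ≤ β) (hS : 0 < ∑ i ∈ s, P.real (E i)) :
    P.real (⋃ i ∈ s, E i \ B i)ᶜ ≤
      4 * (∑ i ∈ s, P.real (E i) + s.card * (d * K)) / (∑ i ∈ s, P.real (E i)) ^ 2 +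
        2 * (s.card * β) / ∑ i ∈ s, P.real (E i) := by
  set S := ∑ i ∈ s, P.real (E i) with hSdef
  set X : Ω → ℝ := fun ω => ∑ i ∈ s, (E i).indicator (fun _ => (1 : ℝ)) ω with hX
  set Y : Ω → ℝ := fun ω => ∑ i ∈ s, (B i).indicator (fun _ => (1 : ℝ)) ω with hY
  have hXmean : P[X] = S := integral_sum_indicator_one s hE
  have hYmean : P[Y] ≤ s.card * β := by
    rw [hY, integral_sum_indicator_one s hB, ← nsmul_eq_mul]
    exact Finset.sum_le_card_nsmul _ _ _ hβ
  have hXL : MemLp X 2 P := memLp_finsetSum _ fun i _ => memLp_indicator_one (hE i)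
  have hYi : Integrable Y P :=
    integrable_finsetSum _ fun i _ => (memLp_indicator_one (hB i)).integrable (by simp)
  have hY0 (ω : Ω) : 0 ≤ Y ω :=
    Finset.sum_nonneg fun i _ => Set.indicator_nonneg (fun _ _ => zero_le_one) ω
  have hcheb : P.real {ω | S / 2 ≤ |X ω - P[X]|} ≤ 4 * (S + s.card * (d * K)) / S ^ 2 := by
    have hV := variance_sum_indicator_le (P := P) s hE N hK hindep hdep hd
    have h := ENNReal.toReal_mono (by simp) (meas_ge_le_variance_div_sq hXL (half_pos hS))
    rw [ENNReal.toReal_ofReal (div_nonneg (variance_nonneg _ _) (sq_nonneg _))] at h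
    refine h.trans ?_
    rw [show 4 * (S + s.card * (d * K)) / S ^ 2 = (S + s.card * (d * K)) / (S / 2) ^ 2 by
      ring]
    gcongr
  have hmark : P.real {ω | S / 2 ≤ Y ω} ≤ 2 * (s.card * β) / S := by
    have h := mul_meas_ge_le_integral_of_nonneg (Eventually.of_forall hY0) hYi (S / 2)
    rw [le_div_iff₀ hS]
    have := h.trans hYmean
    linarith
  -- If every E i that occurs is accompanied by B i, then X ≤ Y. So either X falls to S/2 or below
  -- (Chebyshev), or Y reaches S/2 (Markov).
  refine le_trans (measureReal_mono ?_) ((measureReal_union_le _ _).trans (add_le_add hcheb hmark))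
  intro ω hω
  by_contra hcon
  simp only [Set.mem_union, Set.mem_ofPred_eq, not_or, not_le, hXmean] at hcon
  have hXY : X ω ≤ Y ω := by
    refine Finset.sum_le_sum fun i hi => ?_
    by_cases hEω : ω ∈ E i
    · have hBω : ω ∈ B i := by
        by_contra hBω
        exact hω (Set.mem_biUnion hi ⟨hEω, hBω⟩)
      simp [hEω, hBω]
    · rw [Set.indicator_of_notMem hEω]
      exact Set.indicator_nonneg (fun _ _ => zero_le_one) ω
  have := (abs_lt.1 hcon.1).1
  linarith [hcon.2]

end SecondMoment

/-! ### Lower bounds for the stretch factor -/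

section Deterministic

variable {V : Type*} {x : V → Plane} {G : SimpleGraph V} {u v : V}

lemma edist_le_walkLength (q : G.Walk u v) : edist (x u) (x v) ≤ walkLength x q := by
  induction q with
  | nil => simp
  | @cons u v w h q ih =>
    simp only [walkLength, SimpleGraph.Walk.darts_cons, List.map_cons, List.sum_cons] at ih ⊢
    exact (edist_triangle _ _ _).trans (add_le_add le_rfl ih)

lemma edist_le_graphDist : edist (x u) (x v) ≤ graphDist x G u v :=
  le_iInf edist_le_walkLength

lemma le_graphDist_of_isolated {R : ℝ≥0∞} (huv : u ≠ v) (hadj : ¬ G.Adj u v)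
    (hR : ∀ z, z ≠ u → z ≠ v → R ≤ edist (x u) (x z)) : R ≤ graphDist x G u v := by
  refine le_iInf fun q => ?_
  cases q with
  | nil => exact absurd rfl huv
  | @cons _ z _ h q =>
    have hz : z ≠ v := fun e => hadj (e ▸ h)
    simp only [walkLength, SimpleGraph.Walk.darts_cons, List.map_cons, List.sum_cons]
    exact (hR z h.ne' hz).trans le_self_add

lemma graphDist_div_le_stretchFactor (huv : u ≠ v) :
    graphDist x G u v / edist (x u) (x v) ≤ stretchFactor x G :=
  le_iSup₂_of_le u v (le_iSup_of_le huv le_rfl)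

lemma one_le_stretchFactor (huv : u ≠ v) (hx : x u ≠ x v) : 1 ≤ stretchFactor x G := by
  refine le_trans ?_ (graphDist_div_le_stretchFactor huv)
  rw [← ENNReal.div_self (edist_pos.2 hx).ne' (edist_ne_top _ _)]
  exact ENNReal.div_le_div_right edist_le_graphDist _

lemma ofReal_div_le_stretchFactor {r R : ℝ} (hr : 0 < r) (huv : u ≠ v) (hadj : ¬ G.Adj u v)
    (hclose : dist (x u) (x v) ≤ r) (hfar : ∀ z, z ≠ u → z ≠ v → R ≤ dist (x u) (x z)) :
    ENNReal.ofReal (R / r) ≤ stretchFactor x G := by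
  refine le_trans ?_ (graphDist_div_le_stretchFactor huv)
  rw [ENNReal.ofReal_div_of_pos hr]
  refine ENNReal.div_le_div (le_graphDist_of_isolated huv hadj fun z hzu hzv => ?_) ?_
  · rw [edist_dist]
    exact ENNReal.ofReal_le_ofReal (hfar z hzu hzv)
  · rw [edist_dist]
    exact ENNReal.ofReal_le_ofReal hclose

end Deterministic

/-! ### Close non-adjacent pairs in the random embedded graph -/

section Random

variable {n : ℕ} {p : unitInterval} {r R : ℝ}

instance : IsProbabilityMeasure (randomEmbeddedGraph n p) :=
  inferInstanceAs (IsProbabilityMeasure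
    ((pointsMeasure (Fin n)).prod (SimpleGraph.binomialRandom (Fin n) p)))

lemma randomEmbeddedGraph_real_prod (s : Set (Fin n → Plane)) (t : Set (SimpleGraph (Fin n))) :
    (randomEmbeddedGraph n p).real (s ×ˢ t) =
      (pointsMeasure (Fin n)).real s * (SimpleGraph.binomialRandom (Fin n) p).real t :=
  measureReal_prod_prod s t

/-- The event that `a` and `b` are at distance at most `r` and are not adjacent. -/
def closeNonadj (r : ℝ) (a b : Fin n) : Set ((Fin n → Plane) × SimpleGraph (Fin n)) :=
  {x | dist (x a) (x b) ≤ r} ×ˢ {G | ¬ G.Adj a b}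

/-- The event that `a` and `b` are close and not adjacent, and a third point is within `R` of
`a`. -/
def crowded (r R : ℝ) (a b : Fin n) : Set ((Fin n → Plane) × SimpleGraph (Fin n)) :=
  ⋃ c ∈ (Finset.univ.filter fun c : Fin n => c ≠ a ∧ c ≠ b),
    ({x | dist (x a) (x b) ≤ r} ∩ {x | dist (x a) (x c) ≤ R}) ×ˢ {G | ¬ G.Adj a b}

lemma measurableSet_closeNonadj (r : ℝ) (a b : Fin n) : MeasurableSet (closeNonadj r a b) :=
  (measurableSet_dist_le a b r).prod (measurableSet_not_adj a b)

lemma measurableSet_crowded (r R : ℝ) (a b : Fin n) : MeasurableSet (crowded r R a b) :=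
  Finset.measurableSet_biUnion _ fun c _ =>
    ((measurableSet_dist_le a b r).inter (measurableSet_dist_le a c R)).prod
      (measurableSet_not_adj a b)

lemma binomialRandom_real_not_adj {a b : Fin n} (hab : a ≠ b) :
    (SimpleGraph.binomialRandom (Fin n) p).real {G | ¬ G.Adj a b} = 1 - p := by
  rw [measureReal_def, binomialRandom_not_adj p hab, ENNReal.toReal_ofReal (by linarith [p.2.2])]

lemma binomialRandom_real_not_adj_inter {a b c d : Fin n} (hab : a ≠ b) (hcd : c ≠ d)
    (h : s(a, b) ≠ s(c, d)) :
    (SimpleGraph.binomialRandom (Fin n) p).real ({G | ¬ G.Adj a b} ∩ {G | ¬ G.Adj c d}) =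
      (1 - p) * (1 - p) := by
  rw [measureReal_def, binomialRandom_not_adj_inter p hab hcd h, ENNReal.toReal_mul,
    ENNReal.toReal_ofReal (by linarith [p.2.2])]

lemma pointsMeasure_real_dist_le_dist_le_le {a b c : Fin n} (hab : a ≠ b) (hac : a ≠ c)
    (hbc : b ≠ c) (hr : 0 ≤ r) (hR : 0 ≤ R) :
    (pointsMeasure (Fin n)).real ({x | dist (x a) (x b) ≤ r} ∩ {x | dist (x a) (x c) ≤ R}) ≤
      (Real.pi * r ^ 2) * (Real.pi * R ^ 2) := by
  refine ENNReal.toReal_le_of_le_ofReal (by positivity) ?_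
  rw [ENNReal.ofReal_mul (by positivity)]
  exact pointsMeasure_dist_le_dist_le_le hab hac hbc hr hR

lemma le_real_closeNonadj {a b : Fin n} (hab : a ≠ b) (hr : 0 ≤ r) (hr1 : r ≤ 1) :
    Real.pi / 16 * r ^ 2 * (1 - p) ≤ (randomEmbeddedGraph n p).real (closeNonadj r a b) := by
  rw [closeNonadj, randomEmbeddedGraph_real_prod, binomialRandom_real_not_adj hab]
  refine mul_le_mul_of_nonneg_right ?_ (by linarith [p.2.2])
  rw [measureReal_def, ← ENNReal.ofReal_le_iff_le_toReal (by simp)]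
  exact le_pointsMeasure_dist_le hab hr hr1

lemma real_crowded_le {a b : Fin n} (hab : a ≠ b) (hr : 0 ≤ r) (hR : 0 ≤ R) :
    (randomEmbeddedGraph n p).real (crowded r R a b) ≤
      n * ((Real.pi * r ^ 2) * (Real.pi * R ^ 2) * (1 - p)) := by
  have hq : 0 ≤ 1 - (p : ℝ) := by linarith [p.2.2]
  refine (measureReal_biUnion_finset_le _ _).trans ?_
  calc _ ≤ ∑ c ∈ (Finset.univ.filter fun c : Fin n => c ≠ a ∧ c ≠ b),
        (Real.pi * r ^ 2) * (Real.pi * R ^ 2) * (1 - (p : ℝ)) := by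
        refine Finset.sum_le_sum fun c hc => ?_
        obtain ⟨hca, hcb⟩ := (Finset.mem_filter.1 hc).2
        rw [randomEmbeddedGraph_real_prod, binomialRandom_real_not_adj hab]
        exact mul_le_mul_of_nonneg_right
          (pointsMeasure_real_dist_le_dist_le_le hab hca.symm hcb.symm hr hR) hq
    _ ≤ _ := by
        rw [Finset.sum_const, nsmul_eq_mul]
        gcongr
        simpa using Finset.card_filter_le (Finset.univ : Finset (Fin n)) fun c => c ≠ a ∧ c ≠ b

lemma closeNonadj_comm (r : ℝ) (a b : Fin n) : closeNonadj r a b = closeNonadj r b a := by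
  simp only [closeNonadj, dist_comm, SimpleGraph.adj_comm]

lemma real_closeNonadj_inter_of_disjoint {a b c d : Fin n} (hab : a ≠ b) (hcd : c ≠ d)
    (hac : a ≠ c) (had : a ≠ d) (hbc : b ≠ c) (hbd : b ≠ d) :
    (randomEmbeddedGraph n p).real (closeNonadj r a b ∩ closeNonadj r c d) =
      (randomEmbeddedGraph n p).real (closeNonadj r a b) *
        (randomEmbeddedGraph n p).real (closeNonadj r c d) := by
  have hs : s(a, b) ≠ s(c, d) := by simp [hac, had]
  rw [closeNonadj, closeNonadj, Set.prod_inter_prod, randomEmbeddedGraph_real_prod,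
    randomEmbeddedGraph_real_prod, randomEmbeddedGraph_real_prod,
    binomialRandom_real_not_adj_inter hab hcd hs, binomialRandom_real_not_adj hab,
    binomialRandom_real_not_adj hcd, measureReal_def,
    pointsMeasure_inter_of_disjoint hac had hbc hbd, ENNReal.toReal_mul, ← measureReal_def,
    ← measureReal_def]
  ring

lemma real_closeNonadj_inter_le {a b c : Fin n} (hab : a ≠ b) (hac : a ≠ c) (hbc : b ≠ c)
    (hr : 0 ≤ r) :
    (randomEmbeddedGraph n p).real (closeNonadj r a b ∩ closeNonadj r a c) ≤
      (Real.pi * r ^ 2 * (1 - p)) ^ 2 := by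
  have hs : s(a, b) ≠ s(a, c) := by simp [hbc, hac]
  rw [closeNonadj, closeNonadj, Set.prod_inter_prod, randomEmbeddedGraph_real_prod,
    binomialRandom_real_not_adj_inter hab hac hs,
    show (Real.pi * r ^ 2 * (1 - (p : ℝ))) ^ 2 =
      (Real.pi * r ^ 2) * (Real.pi * r ^ 2) * ((1 - p) * (1 - p)) by ring]
  exact mul_le_mul_of_nonneg_right (pointsMeasure_real_dist_le_dist_le_le hab hac hbc hr hr)
    (mul_self_nonneg _)

/-- Two pairs share a vertex. -/
def SharesVertex (e f : Fin n × Fin n) : Prop :=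
  (f.1 = e.1 ∨ f.1 = e.2) ∨ (f.2 = e.1 ∨ f.2 = e.2)

instance : DecidableRel (SharesVertex (n := n)) := fun _ _ => by
  unfold SharesVertex
  infer_instance

variable (n) in
/-- The pairs `(a, b)` with `a < b`. -/
def increasingPairs : Finset (Fin n × Fin n) :=
  Finset.univ.filter fun e => e.1 < e.2

lemma card_increasingPairs_ge (hn : 2 ≤ n) : (n : ℝ) ^ 2 / 4 ≤ (increasingPairs n).card := by
  have h : (Finset.univ : Finset (Fin n)).offDiag ⊆
      increasingPairs n ∪ (increasingPairs n).image Prod.swap := by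
    intro e he
    rw [Finset.mem_offDiag] at he
    rcases lt_or_gt_of_ne he.2.2 with h | h
    · exact Finset.mem_union_left _ (Finset.mem_filter.2 ⟨Finset.mem_univ _, h⟩)
    · refine Finset.mem_union_right _ (Finset.mem_image.2 ⟨e.swap, ?_, e.swap_swap⟩)
      exact Finset.mem_filter.2 ⟨Finset.mem_univ _, h⟩
  have h2 := (Finset.card_le_card h).trans
    ((Finset.card_union_le _ _).trans (add_le_add le_rfl Finset.card_image_le))
  rw [Finset.offDiag_card, Finset.card_univ, Fintype.card_fin, Nat.sub_le_iff_le_add] at h2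
  have h3 : (n : ℝ) * n ≤
      (increasingPairs n).card + (increasingPairs n).card + n := by exact_mod_cast h2
  have h4 : (2 : ℝ) ≤ n := by exact_mod_cast hn
  nlinarith

lemma card_filter_sharesVertex_le (s : Finset (Fin n × Fin n)) (e : Fin n × Fin n) :
    ((s.filter (SharesVertex e)).card : ℝ) ≤ 4 * n := by
  have h : s.filter (SharesVertex e) ⊆
      ({e.1, e.2} : Finset (Fin n)) ×ˢ Finset.univ ∪ Finset.univ ×ˢ {e.1, e.2} := by
    intro f hf
    rcases (Finset.mem_filter.1 hf).2 with h | h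
    · exact Finset.mem_union_left _ (by simpa using h)
    · exact Finset.mem_union_right _ (by simpa using h)
  have h2 := (Finset.card_le_card h).trans (Finset.card_union_le _ _)
  rw [Finset.card_product, Finset.card_product, Finset.card_univ, Fintype.card_fin] at h2
  have h3 : ({e.1, e.2} : Finset (Fin n)).card ≤ 2 := Finset.card_le_two
  have h4 : (s.filter (SharesVertex e)).card ≤ 4 * n := by nlinarith
  exact_mod_cast h4

/-- Swapping ends moves the shared vertex to the front. The orderings and e ≠ f make the two
remaining ends distinct, so exactly one vertex is shared. -/
lemma real_inter_le_of_sharesVertex {e f : Fin n × Fin n} (he : e ∈ increasingPairs n)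
    (hf : f ∈ increasingPairs n) (hef : e ≠ f) (h : SharesVertex e f) (hr : 0 ≤ r) :
    (randomEmbeddedGraph n p).real (closeNonadj r e.1 e.2 ∩ closeNonadj r f.1 f.2) ≤
      (Real.pi * r ^ 2 * (1 - p)) ^ 2 := by
  obtain ⟨a, b⟩ := e
  obtain ⟨c, d⟩ := f
  have hab : a < b := (Finset.mem_filter.1 he).2
  have hcd : c < d := (Finset.mem_filter.1 hf).2
  simp only [SharesVertex] at h ⊢
  rcases h with (rfl | rfl) | (rfl | rfl)
  · have hbd : b ≠ d := fun h => hef (by rw [h])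
    exact real_closeNonadj_inter_le hab.ne hcd.ne hbd hr
  · rw [closeNonadj_comm r a]
    exact real_closeNonadj_inter_le hab.ne' hcd.ne (hab.trans hcd).ne hr
  · rw [closeNonadj_comm r c]
    exact real_closeNonadj_inter_le hab.ne hcd.ne' (hcd.trans hab).ne' hr
  · have hac : a ≠ c := fun h => hef (by rw [h])
    rw [closeNonadj_comm r a, closeNonadj_comm r c]
    exact real_closeNonadj_inter_le hab.ne' hcd.ne' hac hr

/-- Some pair of close non-adjacent points is far from all the other points, except with a small
probability. -/
lemma real_compl_iUnion_closeNonadj_diff_crowded_le (hn : 2 ≤ n) (hp : (p : ℝ) < 1) (hr : 0 < r)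
    (hr1 : r ≤ 1) (hR : 0 ≤ R) :
    (randomEmbeddedGraph n p).real
        (⋃ e ∈ increasingPairs n, closeNonadj r e.1 e.2 \ crowded r R e.1 e.2)ᶜ ≤
      256 / (Real.pi * (n ^ 2 * r ^ 2 * (1 - p))) + 16384 / n + 32 * Real.pi * (n * R ^ 2) := by
  set P := randomEmbeddedGraph n p
  set q : ℝ := 1 - p with hqdef
  have hq : 0 < q := by linarith
  have hπ := Real.pi_pos
  have hn0 : (0 : ℝ) < n := by exact_mod_cast (by omega : 0 < n)
  set M : ℝ := ((increasingPairs n).card : ℝ) with hMdef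
  have hM : (n : ℝ) ^ 2 / 4 ≤ M := card_increasingPairs_ge hn
  have hM0 : 0 < M := lt_of_lt_of_le (by positivity) hM
  set S : ℝ := ∑ e ∈ increasingPairs n, P.real (closeNonadj r e.1 e.2) with hSdef
  -- Lower bound for the probability of one close non-adjacent pair. The upper bound π r² q is 16 l,
  -- so the joint bound K is (16 l)².
  set l : ℝ := Real.pi / 16 * r ^ 2 * q with hl
  have hl0 : 0 < l := by positivity
  have hne {e : Fin n × Fin n} (he : e ∈ increasingPairs n) : e.1 ≠ e.2 :=
    (Finset.mem_filter.1 he).2.ne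
  have hSl : M * l ≤ S := by
    rw [hMdef, ← nsmul_eq_mul]
    exact Finset.card_nsmul_le_sum _ _ _ fun e he => le_real_closeNonadj (hne he) hr.le hr1
  have hS : 0 < S := lt_of_lt_of_le (by positivity) hSl
  have key := measureReal_compl_iUnion_diff_le (P := P) (increasingPairs n)
    (E := fun e => closeNonadj r e.1 e.2) (B := fun e => crowded r R e.1 e.2)
    (fun e => measurableSet_closeNonadj r _ _) (fun e => measurableSet_crowded r R _ _)
    SharesVertex (K := (Real.pi * r ^ 2 * q) ^ 2) (d := 4 * n)
    (β := n * ((Real.pi * r ^ 2) * (Real.pi * R ^ 2) * q)) (by positivity)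
    (fun e he f hf h => by
      simp only [SharesVertex, not_or] at h
      exact (real_closeNonadj_inter_of_disjoint (hne he) (hne hf) (Ne.symm h.1.1)
        (Ne.symm h.2.1) (Ne.symm h.1.2) (Ne.symm h.2.2)).le)
    (fun e he f hf hef h => real_inter_le_of_sharesVertex he hf hef h hr.le)
    (fun e _ => card_filter_sharesVertex_le _ e)
    (fun e he => real_crowded_le (hne he) hr.le hR) hS
  refine key.trans ?_
  have h1 : 4 * (S + M * (4 * n * (Real.pi * r ^ 2 * q) ^ 2)) / S ^ 2 =
      4 / S + 16 * n * M * (16 * l) ^ 2 / S ^ 2 := by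
    rw [hl]
    field_simp
    ring
  have h2 : 4 / S ≤ 256 / (Real.pi * (n ^ 2 * r ^ 2 * q)) := by
    have : Real.pi * (n ^ 2 * r ^ 2 * q) / 64 ≤ S := by
      refine le_trans ?_ hSl
      rw [hl]
      have := mul_le_mul_of_nonneg_right hM hl0.le
      rw [hl] at this
      linarith
    rw [div_le_div_iff₀ hS (by positivity)]
    linarith
  have h3 : 16 * n * M * (16 * l) ^ 2 / S ^ 2 ≤ 16384 / n := by
    calc _ ≤ 16 * n * M * (16 * l) ^ 2 / (M * l) ^ 2 := by gcongr
      _ = 4096 * n / M := by field_simp; ring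
      _ ≤ 4096 * n / ((n : ℝ) ^ 2 / 4) := by gcongr
      _ = _ := by field_simp; ring
  have h4 : 2 * (M * (n * ((Real.pi * r ^ 2) * (Real.pi * R ^ 2) * q))) / S ≤
      32 * Real.pi * (n * R ^ 2) := by
    rw [div_le_iff₀ hS]
    have := mul_le_mul_of_nonneg_left hSl (by positivity : 0 ≤ 32 * Real.pi * (n * R ^ 2))
    refine le_trans (le_of_eq ?_) this
    rw [hl]
    ring
  rw [h1]
  linarith

lemma ofReal_div_le_stretchFactor_of_mem (hr : 0 < r)
    {ω : (Fin n → Plane) × SimpleGraph (Fin n)}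
    (hω : ω ∈ ⋃ e ∈ increasingPairs n, closeNonadj r e.1 e.2 \ crowded r R e.1 e.2) :
    ENNReal.ofReal (R / r) ≤ stretchFactor ω.1 ω.2 := by
  simp only [Set.mem_iUnion] at hω
  obtain ⟨e, he, ⟨hd, ha⟩, hc⟩ := hω
  refine ofReal_div_le_stretchFactor hr (Finset.mem_filter.1 he).2.ne ha hd fun z hza hzb => ?_
  by_contra hlt
  refine hc (Set.mem_biUnion (x := z) ?_ ⟨⟨hd, (not_le.1 hlt).le⟩, ha⟩)
  simp [hza, hzb]

/-- Two fixed points almost surely differ, which excludes the degenerate ratio with denominator 0.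
-/
lemma ae_one_le_stretchFactor (hn : 2 ≤ n) :
    ∀ᵐ ω ∂randomEmbeddedGraph n p, 1 ≤ stretchFactor ω.1 ω.2 := by
  set a : Fin n := ⟨0, by omega⟩
  set b : Fin n := ⟨1, by omega⟩
  have hab : a ≠ b := by simp [a, b]
  have h0 : pointsMeasure (Fin n) {x | dist (x a) (x b) ≤ 0} = 0 := by
    simpa using pointsMeasure_dist_le_le hab le_rfl
  have hnull : randomEmbeddedGraph n p ({x | dist (x a) (x b) ≤ 0} ×ˢ Set.univ) = 0 := by
    refine (Measure.prod_prod (μ := pointsMeasure (Fin n)) _ _).trans ?_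
    rw [h0, zero_mul]
  filter_upwards [compl_mem_ae_iff.2 hnull] with ω hω
  refine one_le_stretchFactor hab fun h => hω ⟨?_, Set.mem_univ _⟩
  simp [h]

/-- A non-asymptotic form, uniform in p, so no regularity of the sequence p_n is needed in the
limit. -/
lemma sub_le_measure_lt_stretchFactor {w : ℝ} (hn : 2 ≤ n) (hw : 1 ≤ w) :
    ENNReal.ofReal (1 - (500 / w + 16384 / n)) ≤
      randomEmbeddedGraph n p
        {ω | ENNReal.ofReal (√((n : ℝ) * (1 - p)) / w) < stretchFactor ω.1 ω.2} := by
  set P := randomEmbeddedGraph n p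
  have hn0 : (0 : ℝ) < n := by exact_mod_cast (by omega : 0 < n)
  have hw0 : 0 < w := by linarith
  by_cases hsmall : √((n : ℝ) * (1 - p)) < w
  · calc ENNReal.ofReal (1 - (500 / w + 16384 / n)) ≤ 1 := by
          refine ENNReal.ofReal_le_one.2 ?_
          have : 0 ≤ 500 / w + 16384 / (n : ℝ) := by positivity
          linarith
      _ = P Set.univ := measure_univ.symm
      _ ≤ _ := measure_mono_ae ?_
    filter_upwards [ae_one_le_stretchFactor hn] with ω hω _
    refine lt_of_lt_of_le (ENNReal.ofReal_lt_one.2 ?_) hω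
    exact (div_lt_one hw0).2 hsmall
  · push Not at hsmall
    set q : ℝ := 1 - p with hq
    have hnq : w ^ 2 ≤ n * q := (Real.le_sqrt' hw0).1 hsmall
    have hq0 : 0 < q := by
      by_contra h
      nlinarith [mul_nonneg hn0.le (by linarith : 0 ≤ -q)]
    -- Here n²r²q = w/4 and nR² = 1/w. The 4 makes R/r twice the threshold, which gives the strict
    -- inequality.
    set r : ℝ := √(w / (4 * n ^ 2 * q)) with hr
    set R : ℝ := √(1 / (n * w)) with hR
    have hr2 : r ^ 2 = w / (4 * n ^ 2 * q) := Real.sq_sqrt (by positivity)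
    have hR2 : R ^ 2 = 1 / (n * w) := Real.sq_sqrt (by positivity)
    have hr0 : 0 < r := Real.sqrt_pos.2 (by positivity)
    have hR0 : 0 < R := Real.sqrt_pos.2 (by positivity)
    have hn2 : (2 : ℝ) ≤ n := by exact_mod_cast hn
    have hr1 : r ≤ 1 := by
      refine Real.sqrt_le_one.2 ?_
      rw [div_le_one (by positivity)]
      nlinarith [mul_le_mul hn2 hnq (by positivity) hn0.le]
    have hratio : √((n : ℝ) * q) / w < R / r := by
      have hs : 0 < √((n : ℝ) * q) := Real.sqrt_pos.2 (by positivity)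
      refine lt_of_pow_lt_pow_left₀ 2 (by positivity) ?_
      rw [div_pow, div_pow, hr2, hR2, Real.sq_sqrt (by positivity), div_div_eq_mul_div,
        div_lt_div_iff₀ (by positivity) (by positivity)]
      field_simp
      norm_num
    set A := ⋃ e ∈ increasingPairs n, closeNonadj r e.1 e.2 \ crowded r R e.1 e.2 with hA
    have hAm : MeasurableSet A := Finset.measurableSet_biUnion _ fun e _ =>
      (measurableSet_closeNonadj r _ _).diff (measurableSet_crowded r R _ _)
    have hbound := real_compl_iUnion_closeNonadj_diff_crowded_le (p := p) hn
      (by linarith) hr0 hr1 hR0.le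
    rw [← hA, ← hq, hr2, hR2, probReal_compl_eq_one_sub hAm] at hbound
    -- The constants 1024/π ≤ 350 and 32π ≤ 150 add up to the 500 of the statement.
    have h1 : 256 / (Real.pi * (n ^ 2 * (w / (4 * n ^ 2 * q)) * q)) ≤ 350 / w := by
      rw [show Real.pi * (n ^ 2 * (w / (4 * n ^ 2 * q)) * q) = Real.pi * w / 4 by field_simp,
        div_le_div_iff₀ (by positivity) hw0]
      nlinarith [Real.pi_gt_three]
    have h2 : 32 * Real.pi * (n * (1 / (n * w))) ≤ 150 / w := by
      rw [show 32 * Real.pi * (n * (1 / (n * w))) = 32 * Real.pi / w by field_simp]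
      gcongr
      linarith [Real.pi_lt_four]
    calc ENNReal.ofReal (1 - (500 / w + 16384 / n)) ≤ ENNReal.ofReal (P.real A) := by
          refine ENNReal.ofReal_le_ofReal ?_
          have : 500 / w = 350 / w + 150 / w := by ring
          linarith
      _ = P A := ofReal_measureReal (measure_ne_top P A)
      _ ≤ _ := measure_mono fun ω hω => ?_
    refine lt_of_lt_of_le ?_ (ofReal_div_le_stretchFactor_of_mem hr0 hω)
    exact (ENNReal.ofReal_lt_ofReal_iff (by positivity)).2 hratio

end Random

/-! ### Passage to the limit -/

lemma tendsto_measure_lt_stretchFactor (p : ℕ → unitInterval) {w : ℕ → ℝ}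
    (hw : Tendsto w atTop atTop) :
    Tendsto (fun n : ℕ => randomEmbeddedGraph n (p n)
      {ω | ENNReal.ofReal (√((n : ℝ) * (1 - (p n : ℝ))) / w n) < stretchFactor ω.1 ω.2})
      atTop (𝓝 1) := by
  have hlim : Tendsto (fun n : ℕ => ENNReal.ofReal (1 - (500 / w n + 16384 / (n : ℝ)))) atTop
      (𝓝 1) := by
    have h := ((tendsto_const_nhds (x := (500 : ℝ))).div_atTop hw).add
      ((tendsto_const_nhds (x := (16384 : ℝ))).div_atTop (tendsto_natCast_atTop_atTop (R := ℝ)))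
    simpa using ENNReal.tendsto_ofReal (h.const_sub 1)
  refine tendsto_of_tendsto_of_tendsto_of_le_of_le' hlim tendsto_const_nhds ?_
    (Eventually.of_forall fun _ => prob_le_one)
  filter_upwards [hw.eventually_ge_atTop 1, eventually_ge_atTop 2] with n hwn hn
  exact sub_le_measure_lt_stretchFactor hn hwn

lemma tendsto_measure_const_lt_stretchFactor (p : ℕ → unitInterval)
    (hp : Tendsto (fun n : ℕ => (n : ℝ) * (1 - (p n : ℝ))) atTop atTop) (lam : ℝ) :
    Tendsto (fun n : ℕ => randomEmbeddedGraph n (p n)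
      {ω | ENNReal.ofReal lam < stretchFactor ω.1 ω.2}) atTop (𝓝 1) := by
  -- With w = √(n(1 - p))/(|λ| + 1), the threshold of the first part is the constant |λ| + 1 as soon
  -- as n(1 - p) > 0.
  have hpos : 0 < |lam| + 1 := by positivity
  have hw : Tendsto (fun n : ℕ => √((n : ℝ) * (1 - (p n : ℝ))) / (|lam| + 1)) atTop atTop :=
    (Real.tendsto_sqrt_atTop.comp hp).atTop_div_const hpos
  refine tendsto_of_tendsto_of_tendsto_of_le_of_le' (tendsto_measure_lt_stretchFactor p hw)
    tendsto_const_nhds ?_ (Eventually.of_forall fun _ => prob_le_one)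
  filter_upwards [hp.eventually_gt_atTop 0] with n hn
  refine measure_mono fun ω (hω : _ < _) => lt_of_le_of_lt (ENNReal.ofReal_le_ofReal ?_) hω
  rw [div_div_cancel₀ (Real.sqrt_pos.2 hn).ne']
  linarith [le_abs_self lam]

end StretchFactor

theorem theorem1 (p : ℕ → unitInterval) :
    (∀ w : ℕ → ℝ, Tendsto w atTop atTop →
      Tendsto
        (fun n : ℕ => StretchFactor.randomEmbeddedGraph n (p n)
          {ω | ENNReal.ofReal (√((n : ℝ) * (1 - (p n : ℝ))) / w n) <
            StretchFactor.stretchFactor ω.1 ω.2})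
        atTop (𝓝 1)) ∧
    (Tendsto (fun n : ℕ => (n : ℝ) * (1 - (p n : ℝ))) atTop atTop →
      ∀ lam : ℝ,
        Tendsto
          (fun n : ℕ => StretchFactor.randomEmbeddedGraph n (p n)
            {ω | ENNReal.ofReal lam < StretchFactor.stretchFactor ω.1 ω.2})
          atTop (𝓝 1)) :=
  ⟨fun _ hw => StretchFactor.tendsto_measure_lt_stretchFactor p hw,
    fun hp lam => StretchFactor.tendsto_measure_const_lt_stretchFactor p hp lam⟩
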